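/- Let $R$ be a ring (associative, with unit), let $R$-Mod be the category of left $R$-modules, and let $n\in\mathbb{N}\cup\{\infty\}$ (with $\infty+1=\infty$). Let $\mathcal{P}^{<n+1}$ be the class of modules $M$ admitting, for some natural number $k<n+1$, an exact sequence $0\to P_k\to\cdots\to P_0\to M\to 0$ with all $P_i$ finitely generated projective. A short exact sequence $0\to A\to B\to C\to 0$ in $R$-Mod is called $n$-exact if $0\to \mathrm{Hom}_R(M,A)\to \mathrm{Hom}_R(M,B)\to \mathrm{Hom}_R(M,C)\to 0$ is exact for every $M\in\mathcal{P}^{<n+1}$. A cochain complex $X^\bullet$ of $R$-modules is called $n$-exact if for every $i\in\mathbb{Z}$ the sequence $0\to \mathrm{Ker}(d^{i})\to X^{i}\to \mathrm{Coker}(d^{i-1})\to 0$ is an $n$-exact short exact sequence. Let $\boldsymbol{K}^b(R)$ be the homotopy category of bounded complexes of $R$-modules, let $\boldsymbol{K}^b_n(R)$ be its full subcategory of $n$-exact complexes, and let $\boldsymbol{D}^b_n(R):=\boldsymbol{K}^b(R)/\boldsymbol{K}^b_n(R)$ be the Verdier quotient. Theorem. The composition of functors $$R\text{-Mod}\longrightarrow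 \boldsymbol{K}^b(R)\longrightarrow \boldsymbol{D}^b_n(R),$$ where the first functor sends a module to the corresponding stalk complex concentrated in degree $0$ and the second is the quotient functor, is fully faithful. -/

import Mathlib

open CategoryTheory CategoryTheory.Limits CategoryTheory.Pretriangulated Opposite
open scoped ZeroObject

universe u v

noncomputable section

namespace NDerived

variable {R : Type u} [Ring R]

/-- `M` has a projective resolution `0 → P_k → ⋯ → P_0 → M → 0` of length at most `k`
by finitely generated projective modules. -/
def HasFinProjResolution (k : ℕ) (M : ModuleCat.{v} R) : Prop :=
  ∃ P : ProjectiveResolution M,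
    (∀ i, Module.Finite R (P.complex.X i)) ∧ ∀ i, k < i → IsZero (P.complex.X i)

/-- The class `𝒫^{<n}` of modules with a finite projective resolution (by finitely generated
projectives) of length less than `n`; for `n = ∞` all modules with a finite projective
resolution, for `n = 0` only the zero modules. -/
def FinProjLT (n : ℕ∞) (M : ModuleCat.{v} R) : Prop :=
  IsZero M ∨ ∃ k : ℕ, (k : ℕ∞) < n ∧ HasFinProjResolution k M

/-- A short exact sequence `0 → A → B → C → 0` is `n`-exact if
`0 → Hom(M, A) → Hom(M, B) → Hom(M, C) → 0` is exact for every `M ∈ 𝒫^{<n+1}`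
(in `ℕ∞` one has `∞ + 1 = ∞`). -/
def IsNExact (n : ℕ∞) (S : ShortComplex (ModuleCat.{v} R)) : Prop :=
  S.ShortExact ∧ ∀ M : ModuleCat.{v} R, FinProjLT (n + 1) M →
    (S.map (preadditiveCoyoneda.obj (op M))).ShortExact

/-- A cochain complex `X` is `n`-exact at `i` if the sequence
`0 → Ker dⁱ → Xⁱ → Coker dⁱ⁻¹ → 0` is (a short exact sequence and) `n`-exact. -/
def IsNExactAt (n : ℕ∞) (X : CochainComplex (ModuleCat.{v} R) ℤ) (i : ℤ) : Prop :=
  ∃ w : kernel.ι (X.d i (i + 1)) ≫ cokernel.π (X.d (i - 1) i) = 0,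
    IsNExact n (ShortComplex.mk (kernel.ι (X.d i (i + 1))) (cokernel.π (X.d (i - 1) i)) w)

/-- A cochain complex is `n`-exact if it is `n`-exact at every `i : ℤ`. -/
def IsNExactComplex (n : ℕ∞) (X : CochainComplex (ModuleCat.{v} R) ℤ) : Prop :=
  ∀ i : ℤ, IsNExactAt n X i

variable (R)

/-- The property of objects of the homotopy category `K(R)` that the underlying
complex is bounded (both below and above). -/
def bounded : ObjectProperty (HomotopyCategory (ModuleCat.{v} R) (ComplexShape.up ℤ)) :=
  fun X => ∃ a b : ℤ, CochainComplex.IsStrictlyGE X.as a ∧ CochainComplex.IsStrictlyLE X.as b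

lemma bounded_quotient_obj_iff (K : CochainComplex (ModuleCat.{v} R) ℤ) :
    bounded R ((HomotopyCategory.quotient _ _).obj K) ↔
      ∃ a b : ℤ, K.IsStrictlyGE a ∧ K.IsStrictlyLE b := Iff.rfl

instance : (bounded.{u, v} R).ContainsZero where
  exists_zero :=
    ⟨(HomotopyCategory.quotient _ _).obj 0, Functor.map_isZero _ (isZero_zero _), by
      rw [bounded_quotient_obj_iff]
      exact ⟨0, 0, inferInstance, inferInstance⟩⟩

instance : (bounded.{u, v} R).IsStableUnderShift ℤ where
  isStableUnderShiftBy n :=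
    { le_shift K hK := by
        obtain ⟨K : CochainComplex _ _, rfl⟩ := K.quotient_obj_surjective
        rw [bounded_quotient_obj_iff] at hK
        obtain ⟨a, b, _, _⟩ := hK
        rw [ObjectProperty.prop_shift_iff, HomotopyCategory.shift_quotient_obj,
          bounded_quotient_obj_iff]
        exact ⟨a - n, b - n, K.isStrictlyGE_shift a n (a - n) (by lia),
          K.isStrictlyLE_shift b n (b - n) (by lia)⟩ }

lemma bounded_mappingCone {K L : CochainComplex (ModuleCat.{v} R) ℤ} (f : K ⟶ L)
    (hK : ∃ a b : ℤ, K.IsStrictlyGE a ∧ K.IsStrictlyLE b)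
    (hL : ∃ a b : ℤ, L.IsStrictlyGE a ∧ L.IsStrictlyLE b) :
    ∃ a b : ℤ, (CochainComplex.mappingCone f).IsStrictlyGE a ∧
      (CochainComplex.mappingCone f).IsStrictlyLE b := by
  obtain ⟨a, b, _, _⟩ := hK
  obtain ⟨a', b', _, _⟩ := hL
  refine ⟨min (a - 1) a', max b b', ?_, ?_⟩
  · rw [CochainComplex.isStrictlyGE_iff]
    intro i hi
    simp only [lt_inf_iff] at hi
    rw [CochainComplex.mappingCone.isZero_X_iff]
    exact ⟨K.isZero_of_isStrictlyGE a _, L.isZero_of_isStrictlyGE a' _⟩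
  · rw [CochainComplex.isStrictlyLE_iff]
    intro i hi
    simp only [sup_lt_iff] at hi
    rw [CochainComplex.mappingCone.isZero_X_iff]
    exact ⟨K.isZero_of_isStrictlyLE b _, L.isZero_of_isStrictlyLE b' _⟩

instance : (bounded.{u, v} R).IsTriangulatedClosed₃ where
  ext₃' T hT h₁ h₂ := by
    obtain ⟨f : T.obj₁.as ⟶ T.obj₂.as, hf⟩ :=
      (HomotopyCategory.quotient _ _).map_surjective T.mor₁
    obtain ⟨e, -⟩ := exists_iso_of_arrow_iso T _ hT
      (HomotopyCategory.mappingCone_triangleh_distinguished f)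
      (Arrow.isoMk (Iso.refl _) (Iso.refl _) (by
        exact (Category.id_comp _).trans (hf.trans (Category.comp_id _).symm)))
    exact ⟨_, bounded_mappingCone R f h₁ h₂, ⟨Triangle.π₃.mapIso e⟩⟩

instance : (bounded.{u, v} R).IsTriangulated where
  toIsTriangulatedClosed₂ := .of_isTriangulatedClosed₃

/-- The bounded homotopy category `K^b(R)`, a triangulated category (with the structure
of full triangulated subcategory of `K(R)`). -/
abbrev Kb : Type _ := (bounded.{u, v} R).FullSubcategory

/-- The objects of `K^b(R)` that are `n`-exact complexes: the subcategory `K^b_n(R)`. -/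
def nExactKb (n : ℕ∞) : ObjectProperty (Kb.{u, v} R) :=
  fun X => IsNExactComplex n X.obj.as

/-- The bounded `n`-derived category `D^b_n(R)`, i.e. the Verdier quotient `K^b(R)/K^b_n(R)`:
the localization of `K^b(R)` at the morphisms whose cone belongs to `K^b_n(R)`. -/
abbrev Db (n : ℕ∞) : Type _ := (nExactKb.{u, v} R n).trW.Localization

/-- The quotient functor `K^b(R) ⥤ D^b_n(R)`. -/
abbrev quotientFunctor (n : ℕ∞) : Kb.{u, v} R ⥤ Db.{u, v} R n :=
  (nExactKb.{u, v} R n).trW.Q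

/-- The functor `R-Mod ⥤ K^b(R)` sending a module to its stalk complex in degree `0`. -/
def stalk : ModuleCat.{v} R ⥤ Kb.{u, v} R :=
  (bounded.{u, v} R).lift (HomotopyCategory.singleFunctor (ModuleCat.{v} R) 0) (fun M => by
    rw [← HomotopyCategory.quotient_obj_singleFunctors_obj, bounded_quotient_obj_iff]
    exact ⟨0, 0, inferInstance, inferInstance⟩)

end NDerived

end

/-! A complex `X` is `n`-exact iff `Hom(T, X)` is acyclic for all `T ∈ 𝒫^{<n+1}`, i.e. iff `X` is
right orthogonal in `K(R)` to all shifts of stalks of such `T` (`nExactKb_eq_inverseImage`). Hence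
the morphisms to be inverted are those inducing bijections on maps from these stalks
(`trW_nExactKb_iff`).

Full: a morphism is a roof `M ⟵ X ⟶ N` with left leg `s` inverted. A stalk in positive degree has no
nonzero map to `M`, hence none to `X`, so the inclusion of the truncation `τ≤0 X` is also inverted
(`isColocal_quotient_map_truncι`). Testing against `T = R`, which lies in `𝒫^{<n+1}`, identifies `M`
with `H⁰(τ≤0 X)`, the cokernel of the last differential; a chain map `τ≤0 X ⟶ N` kills boundaries,
so it factors through `M` (`exists_eq_comp_single_map`).

Faithful: if `s ≫ g = s ≫ g'` with `s` inverted, every element of `M`, seen as a map `R ⟶ M`, lifts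
through `s`, so `g` and `g'` agree on it. -/

noncomputable section

/-! ### Cones in a right orthogonal. -/

namespace CategoryTheory.ObjectProperty

variable {C : Type*} [Category* C] [HasZeroObject C] [HasShift C ℤ] [Preadditive C]
  [∀ (n : ℤ), (shiftFunctor C n).Additive] [Pretriangulated C]

/-- The morphisms whose cone is right orthogonal to `P` are those which induce bijections
on morphisms from the objects of `P`. -/
lemma trW_rightOrthogonal_eq_isColocal (P : ObjectProperty C) [P.IsStableUnderShift ℤ] :
    P.rightOrthogonal.trW = P.isColocal := by
  ext X Y f
  refine ⟨fun ⟨Z, g, h, hT, hZ⟩ A hA ↦ ⟨?_, fun a ↦ ?_⟩, fun hf ↦ ?_⟩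
  · suffices ∀ (a : A ⟶ X), a ≫ f = 0 → a = 0 from fun a₁ a₂ ha ↦ by
      simpa [sub_eq_zero] using this (a₁ - a₂) (by simpa [sub_eq_zero] using ha)
    intro a ha
    obtain ⟨b, rfl⟩ := Triangle.coyoneda_exact₂ _ (inv_rot_of_distTriang _ hT) a ha
    have hb : b = 0 := P.rightOrthogonal.le_shift (-1) _ hZ b hA
    rw [hb]
    exact zero_comp
  · obtain ⟨b, rfl⟩ := Triangle.coyoneda_exact₂ _ hT a (hZ _ hA)
    exact ⟨b, rfl⟩
  · obtain ⟨Z, g, h, hT⟩ := distinguished_cocone_triangle f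
    refine ⟨Z, g, h, hT, fun A a hA ↦ ?_⟩
    have hA' := P.le_shift (-1) _ hA
    -- Injectivity for `f⟦1⟧` on maps from `A` is injectivity for `f` on maps from `A⟦-1⟧`, which is
    -- still in `P`.
    have hX : ∀ (b : A ⟶ X⟦(1 : ℤ)⟧), b ≫ f⟦(1 : ℤ)⟧' = 0 → b = 0 := fun b hb ↦ by
      apply (shiftFunctor C (-1 : ℤ)).map_injective
      rw [Functor.map_zero,
        ← cancel_mono ((shiftFunctorCompIsoId C (1 : ℤ) (-1) (by simp)).hom.app X)]
      apply (hf _ hA').1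
      have := (shiftFunctorCompIsoId C (1 : ℤ) (-1) (by simp)).hom.naturality f
      dsimp at this ⊢
      rw [Category.assoc, ← this, ← Functor.map_comp_assoc, hb]
      simp
    obtain ⟨b, rfl⟩ := Triangle.coyoneda_exact₃ _ hT a
      (hX _ ((Category.assoc _ _ _).trans
        ((congrArg (a ≫ ·) (comp_distTriang_mor_zero₃₁ _ hT)).trans comp_zero)))
    obtain ⟨c, rfl⟩ := (hf _ hA).2 b
    exact (Category.assoc _ _ _).trans
      ((congrArg (c ≫ ·) (comp_distTriang_mor_zero₁₂ _ hT)).trans comp_zero)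

end CategoryTheory.ObjectProperty

/-! ### Maps from stalk complexes up to homotopy. -/

namespace CochainComplex

open HomologicalComplex

variable {C : Type*} [Category* C] [Preadditive C] [HasZeroObject C]

/-- A morphism from a stalk complex vanishes in the homotopy category if and only if
the cocycle it corresponds to is a coboundary. -/
lemma quotient_map_mkHomFromSingle_eq_zero_iff {K : CochainComplex C ℤ} {A : C} {i j : ℤ}
    (hij : j + 1 = i) (φ : A ⟶ K.X i)
    (hφ : ∀ k, (ComplexShape.up ℤ).Rel i k → φ ≫ K.d i k = 0) :
    (HomotopyCategory.quotient C (ComplexShape.up ℤ)).map (mkHomFromSingle φ hφ) = 0 ↔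
      ∃ ψ : A ⟶ K.X j, ψ ≫ K.d j i = φ := by
  constructor
  · intro h
    have H := (HomotopyCategory.homotopyOfEq _ _
      (h.trans (Functor.map_zero _ _ _).symm)).comm i
    rw [dNext_eq _ (show (ComplexShape.up ℤ).Rel i (i + 1) from rfl),
      prevD_eq _ (show (ComplexShape.up ℤ).Rel j i from hij)] at H
    refine ⟨(singleObjXSelf (ComplexShape.up ℤ) i A).inv ≫
      (HomotopyCategory.homotopyOfEq _ _ (h.trans (Functor.map_zero _ _ _).symm)).hom i j, ?_⟩
    rw [← cancel_epi (singleObjXSelf (ComplexShape.up ℤ) i A).hom]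
    simpa using H.symm
  · rintro ⟨ψ, rfl⟩
    rw [← (HomotopyCategory.quotient C (ComplexShape.up ℤ)).map_zero]
    -- The only nonzero component of the homotopy is `ψ`, from degree `i` to degree `j`.
    let h : ∀ p q, (ComplexShape.up ℤ).Rel q p →
        (((single C (ComplexShape.up ℤ) i).obj A).X p ⟶ K.X q) := fun p q hqp ↦
      if hp : p = i then (singleObjXIsoOfEq (ComplexShape.up ℤ) i A p hp).hom ≫ ψ ≫
        (K.XIsoOfEq (show j = q by have : q + 1 = p := hqp; lia)).hom else 0
    refine HomotopyCategory.eq_of_homotopy _ _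
      ((Homotopy.ofEq ?_).trans (Homotopy.nullHomotopy' h))
    ext
    rw [Homotopy.nullHomotopicMap'_f (show (ComplexShape.up ℤ).Rel j i from hij)
      (show (ComplexShape.up ℤ).Rel i (i + 1) from rfl)]
    simp [h, singleObjXSelf]

end CochainComplex

/-! ### `n`-exactness as acyclicity of `Hom(T, -)`. -/

namespace NDerived

variable {R : Type u} [Ring R]

lemma FinProjLT.of_finite_projective (n : ℕ∞) (P : ModuleCat.{v} R) [Module.Finite R P]
    [Projective P] : FinProjLT (n + 1) P :=
  Or.inr ⟨0, by simp, .self P, fun i ↦ by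
    obtain _ | i := i
    · exact inferInstanceAs (Module.Finite R P)
    · have := ModuleCat.subsingleton_of_isZero
        (HomologicalComplex.isZero_single_obj_X (ComplexShape.down ℕ) 0 P (i + 1) (by simp))
      exact inferInstanceAs (Module.Finite R
        (((HomologicalComplex.single _ (ComplexShape.down ℕ) 0).obj P).X (i + 1))),
    fun i hi ↦ HomologicalComplex.isZero_single_obj_X _ _ _ _ hi.ne'⟩

lemma FinProjLT.ringSelf [Small.{v} R] (n : ℕ∞) :
    FinProjLT (n + 1) (ModuleCat.of R (Shrink.{v} R)) := by
  have : Module.Finite R (Shrink.{v} R) := .equiv (Shrink.linearEquiv R R).symm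
  have : Projective (ModuleCat.of R (Shrink.{v} R)) :=
    (IsProjective.iff_projective _).1 (.of_equiv (Shrink.linearEquiv R R).symm)
  exact .of_finite_projective n _

/-- The complex `Hom(T, X)` is acyclic. -/
def HomAcyclic (T : ModuleCat.{v} R) (X : CochainComplex (ModuleCat.{v} R) ℤ) : Prop :=
  ∀ (i j k : ℤ) (_ : i + 1 = j) (_ : j + 1 = k) (φ : T ⟶ X.X j), φ ≫ X.d j k = 0 →
    ∃ ψ : T ⟶ X.X i, ψ ≫ X.d i j = φ

variable (R) in
/-- The module `R`, in the universe `v`. -/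
abbrev ringSelf [Small.{v} R] : ModuleCat.{v} R := ModuleCat.of R (Shrink.{v} R)

/-- The morphism `R ⟶ M` corresponding to an element of `M`. -/
def ofElement [Small.{v} R] {M : ModuleCat.{v} R} (x : M) : ringSelf.{u, v} R ⟶ M :=
  ModuleCat.ofHom (LinearMap.toSpanSingleton R M x ∘ₗ (Shrink.linearEquiv R R).toLinearMap)

@[simp]
lemma ofElement_apply_one [Small.{v} R] {M : ModuleCat.{v} R} (x : M) :
    ofElement x ((Shrink.linearEquiv R R).symm 1) = x := by
  simp [ofElement]

lemma ofElement_comp [Small.{v} R] {M N : ModuleCat.{v} R} (x : M) (f : M ⟶ N) :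
    ofElement x ≫ f = ofElement (f x) := by
  ext
  simp [ofElement]

lemma ofElement_zero [Small.{v} R] {M : ModuleCat.{v} R} : ofElement (0 : M) = 0 := by
  ext
  simp [ofElement]

lemma HomAcyclic.exists_of_apply_eq_zero [Small.{v} R]
    {X : CochainComplex (ModuleCat.{v} R) ℤ} (hX : HomAcyclic (ringSelf R) X)
    {i j k : ℤ} (hij : i + 1 = j) (hjk : j + 1 = k) (x : X.X j) (hx : X.d j k x = 0) :
    ∃ y : X.X i, X.d i j y = x := by
  obtain ⟨ψ, hψ⟩ := hX i j k hij hjk (ofElement x) (by rw [ofElement_comp, hx, ofElement_zero])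
  refine ⟨ψ ((Shrink.linearEquiv R R).symm 1), ?_⟩
  rw [← ModuleCat.comp_apply, hψ, ofElement_apply_one]

lemma cokernel_π_eq_zero_iff {M N : ModuleCat.{v} R} (f : M ⟶ N) (x : N) :
    cokernel.π f x = 0 ↔ ∃ y, f y = x := by
  refine ⟨(ShortComplex.moduleCat_exact_iff _).1 (ShortComplex.exact_cokernel f) x, ?_⟩
  rintro ⟨y, rfl⟩
  rw [← ModuleCat.comp_apply, cokernel.condition]
  rfl

lemma exists_kernel_ι_apply_eq_iff {M N : ModuleCat.{v} R} (f : M ⟶ N) (x : M) :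
    (∃ y, kernel.ι f y = x) ↔ f x = 0 := by
  refine ⟨?_, (ShortComplex.moduleCat_exact_iff _).1 (ShortComplex.exact_kernel f) x⟩
  rintro ⟨y, rfl⟩
  rw [← ModuleCat.comp_apply, kernel.condition]
  rfl

/-- If `X` is exact at `i`, the map `Coker dⁱ⁻¹ ⟶ Xⁱ⁺¹` is a monomorphism. -/
lemma mono_cokernel_desc {X : CochainComplex (ModuleCat.{v} R) ℤ} {i j k : ℤ}
    (h : ∀ x, X.d j k x = 0 → ∃ y, X.d i j y = x) :
    Mono (cokernel.desc (X.d i j) (X.d j k) (X.d_comp_d i j k)) := by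
  rw [ModuleCat.mono_iff_injective, injective_iff_map_eq_zero]
  intro y hy
  obtain ⟨x, rfl⟩ := (ModuleCat.epi_iff_surjective (cokernel.π (X.d i j))).1 inferInstance y
  rw [← ModuleCat.comp_apply, cokernel.π_desc] at hy
  exact (cokernel_π_eq_zero_iff _ _).2 (h x hy)

lemma isNExactAt_exact {n : ℕ∞} {X : CochainComplex (ModuleCat.{v} R) ℤ} {i : ℤ}
    (h : IsNExactAt n X i) (x : X.X i) (hx : X.d i (i + 1) x = 0) :
    ∃ y, X.d (i - 1) i y = x := by
  obtain ⟨w, -⟩ := h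
  obtain ⟨y, rfl⟩ := (exists_kernel_ι_apply_eq_iff _ _).2 hx
  rw [← cokernel_π_eq_zero_iff, ← ModuleCat.comp_apply, w]
  rfl

/-- By exactness `Coker dⁱ⁻¹` is the kernel of `dⁱ⁺¹`, so a cocycle `T ⟶ Xⁱ⁺¹` factors through it,
and `n`-exactness at `i` lifts the factorization to `Xⁱ`: the sequence at `i` controls the
cohomology at `i + 1`. -/
lemma IsNExactComplex.homAcyclic {n : ℕ∞} {X : CochainComplex (ModuleCat.{v} R) ℤ}
    (hX : IsNExactComplex n X) {T : ModuleCat.{v} R} (hT : FinProjLT (n + 1) T) :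
    HomAcyclic T X := by
  rintro i _ _ rfl rfl φ hφ
  let m := cokernel.desc (X.d (i - 1) i) (X.d i (i + 1)) (X.d_comp_d _ _ _)
  have hm : Mono m := mono_cokernel_desc (isNExactAt_exact (hX i))
  have hπm : cokernel.π _ ≫ m = X.d i (i + 1) := cokernel.π_desc _ _ _
  let S := ShortComplex.mk m (X.d (i + 1) (i + 1 + 1)) (by
    rw [← cancel_epi (cokernel.π _), reassoc_of% hπm]; simp)
  have : Mono S.f := hm
  have hS : S.Exact := by
    rw [ShortComplex.moduleCat_exact_iff]
    intro x hx
    have H := isNExactAt_exact (hX (i + 1)) x hx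
    rw [show i + 1 - 1 = i by lia] at H
    obtain ⟨y, rfl⟩ := H
    exact ⟨cokernel.π (X.d (i - 1) i) y, by
      rw [← ModuleCat.comp_apply]; exact congr($hπm y)⟩
  obtain ⟨_, -, h⟩ := hX i
  have := (h T hT).epi_g
  obtain ⟨ψ, hψ⟩ : ∃ ψ : T ⟶ X.X i, ψ ≫ cokernel.π (X.d (i - 1) i) = hS.lift φ hφ :=
    (AddCommGrpCat.epi_iff_surjective _).1 this (hS.lift φ hφ)
  refine ⟨ψ, ?_⟩
  rw [← hπm, reassoc_of% hψ]
  exact hS.lift_f φ hφ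

/-- The case `T = R` gives ordinary exactness, which makes `Coker dⁱ⁻¹ ⟶ Xⁱ⁺¹` mono; lifting
problems to `Coker dⁱ⁻¹` then become problems about cocycles in `Xⁱ⁺¹`. -/
lemma isNExactComplex_of_homAcyclic [Small.{v} R] {n : ℕ∞}
    {X : CochainComplex (ModuleCat.{v} R) ℤ}
    (hX : ∀ T, FinProjLT (n + 1) T → HomAcyclic T X) :
    IsNExactComplex n X := by
  intro i
  have hex : ∀ x, X.d i (i + 1) x = 0 → ∃ y, X.d (i - 1) i y = x :=
    (hX _ (.ringSelf n)).exists_of_apply_eq_zero (by lia) rfl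
  have w : kernel.ι (X.d i (i + 1)) ≫ cokernel.π (X.d (i - 1) i) = 0 := by
    ext x
    exact (cokernel_π_eq_zero_iff _ _).2
      (hex _ ((exists_kernel_ι_apply_eq_iff _ _).1 ⟨x, rfl⟩))
  let m := cokernel.desc (X.d (i - 1) i) (X.d i (i + 1)) (X.d_comp_d _ _ _)
  have hm : Mono m := mono_cokernel_desc hex
  have hπm : cokernel.π _ ≫ m = X.d i (i + 1) := cokernel.π_desc _ _ _
  let S := ShortComplex.mk _ _ w
  have hS : S.Exact := by
    rw [ShortComplex.moduleCat_exact_iff]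
    intro x hx
    refine (exists_kernel_ι_apply_eq_iff _ _).2 ?_
    obtain ⟨y, rfl⟩ := (cokernel_π_eq_zero_iff _ _).1 hx
    rw [← ModuleCat.comp_apply, X.d_comp_d]
    rfl
  have : Mono S.f := inferInstanceAs (Mono (kernel.ι _))
  have : Epi S.g := inferInstanceAs (Epi (cokernel.π _))
  refine ⟨w, ⟨hS⟩, fun T hT ↦ ?_⟩
  have hmono : Mono (S.map (preadditiveCoyoneda.obj (op T))).f := by
    rw [AddCommGrpCat.mono_iff_injective]
    intro a b hab
    exact (cancel_mono S.f).1 hab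
  have hepi : Epi (S.map (preadditiveCoyoneda.obj (op T))).g := by
    rw [AddCommGrpCat.epi_iff_surjective]
    intro (χ : T ⟶ cokernel _)
    obtain ⟨ψ, hψ⟩ := hX T hT i (i + 1) _ rfl rfl (χ ≫ m) (by
      rw [Category.assoc, show m ≫ X.d (i + 1) (i + 1 + 1) = 0 from by
        rw [← cancel_epi (cokernel.π _), reassoc_of% hπm]; simp, comp_zero])
    refine ⟨ψ, ?_⟩
    change ψ ≫ cokernel.π _ = χ
    rw [← cancel_mono m, Category.assoc, hπm, hψ]
  refine ⟨?_⟩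
  rw [ShortComplex.ab_exact_iff]
  intro (a : T ⟶ X.X i) ha
  exact ⟨hS.lift a ha, hS.lift_f a ha⟩

/-- A complex `X` is `n`-exact if and only if `Hom(T, X)` is acyclic for every `T ∈ 𝒫^{<n+1}`. -/
lemma isNExactComplex_iff [Small.{v} R] {n : ℕ∞} {X : CochainComplex (ModuleCat.{v} R) ℤ} :
    IsNExactComplex n X ↔ ∀ T, FinProjLT (n + 1) T → HomAcyclic T X :=
  ⟨fun h _ hT ↦ h.homAcyclic hT, isNExactComplex_of_homAcyclic⟩

/-! ### `n`-exact complexes as a right orthogonal. -/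

open HomologicalComplex

variable (R) in
/-- The shifts in `K(R)` of the stalk complexes of the modules in `𝒫^{<n+1}`. -/
def finProjStalks (n : ℕ∞) :
    ObjectProperty (HomotopyCategory (ModuleCat.{v} R) (ComplexShape.up ℤ)) :=
  fun X ↦ ∃ (i : ℤ) (T : ModuleCat.{v} R), FinProjLT (n + 1) T ∧
    Nonempty (X ≅ (HomotopyCategory.singleFunctor (ModuleCat.{v} R) i).obj T)

instance (n : ℕ∞) : (finProjStalks.{u, v} R n).IsStableUnderShift ℤ where
  isStableUnderShiftBy a := ⟨fun X ⟨i, T, hT, ⟨e⟩⟩ ↦ ⟨i - a, T, hT,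
    ⟨(shiftFunctor _ a).mapIso e ≪≫
      ((HomotopyCategory.singleFunctors (ModuleCat.{v} R)).shiftIso a (i - a) i
        (by lia)).app T⟩⟩⟩

lemma mkHomFromSingle_comp {K L : CochainComplex (ModuleCat.{v} R) ℤ} {T : ModuleCat.{v} R}
    {i : ℤ} (φ : T ⟶ K.X i) (hφ : ∀ k, (ComplexShape.up ℤ).Rel i k → φ ≫ K.d i k = 0)
    (f : K ⟶ L) :
    mkHomFromSingle φ hφ ≫ f = mkHomFromSingle (φ ≫ f.f i) (fun k hk ↦ by
      rw [Category.assoc, f.comm, reassoc_of% hφ k hk, zero_comp]) := by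
  ext1
  simp

/-- The morphism in `K(R)` from a stalk complex which corresponds to a cocycle. -/
def homOfCocycle {K : CochainComplex (ModuleCat.{v} R) ℤ} {T : ModuleCat.{v} R} {i : ℤ}
    (φ : T ⟶ K.X i) (hφ : φ ≫ K.d i (i + 1) = 0) :
    (HomotopyCategory.singleFunctor (ModuleCat.{v} R) i).obj T ⟶
      (HomotopyCategory.quotient _ _).obj K :=
  (HomotopyCategory.quotient _ _).map (mkHomFromSingle φ (by rintro _ rfl; exact hφ))

lemma homOfCocycle_eq_zero_iff {K : CochainComplex (ModuleCat.{v} R) ℤ} {T : ModuleCat.{v} R}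
    {i j : ℤ} (hij : j + 1 = i) (φ : T ⟶ K.X i) (hφ : φ ≫ K.d i (i + 1) = 0) :
    homOfCocycle φ hφ = 0 ↔ ∃ ψ : T ⟶ K.X j, ψ ≫ K.d j i = φ :=
  CochainComplex.quotient_map_mkHomFromSingle_eq_zero_iff hij φ _

lemma homOfCocycle_comp {K L : CochainComplex (ModuleCat.{v} R) ℤ} {T : ModuleCat.{v} R}
    {i : ℤ} (φ : T ⟶ K.X i) (hφ : φ ≫ K.d i (i + 1) = 0) (f : K ⟶ L) :
    homOfCocycle φ hφ ≫ (HomotopyCategory.quotient _ _).map f =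
      homOfCocycle (φ ≫ f.f i) (by
        rw [Category.assoc, f.comm, reassoc_of% hφ, zero_comp]) := by
  refine ((HomotopyCategory.quotient _ _).map_comp _ _).symm.trans
    (congrArg (HomotopyCategory.quotient _ _).map (mkHomFromSingle_comp _ _ _))

lemma homOfCocycle_comp_eq_zero_iff {K L : CochainComplex (ModuleCat.{v} R) ℤ}
    {T : ModuleCat.{v} R} {i j : ℤ} (hij : j + 1 = i) (φ : T ⟶ K.X i)
    (hφ : φ ≫ K.d i (i + 1) = 0) (f : K ⟶ L) :
    homOfCocycle φ hφ ≫ (HomotopyCategory.quotient _ _).map f = 0 ↔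
      ∃ ψ : T ⟶ L.X j, ψ ≫ L.d j i = φ ≫ f.f i := by
  rw [homOfCocycle_comp, homOfCocycle_eq_zero_iff hij]

lemma exists_homOfCocycle {K : CochainComplex (ModuleCat.{v} R) ℤ} {T : ModuleCat.{v} R}
    {i : ℤ} (a : (HomotopyCategory.singleFunctor (ModuleCat.{v} R) i).obj T ⟶
      (HomotopyCategory.quotient _ _).obj K) :
    ∃ (φ : T ⟶ K.X i) (hφ : φ ≫ K.d i (i + 1) = 0), a = homOfCocycle φ hφ := by
  obtain ⟨f, rfl⟩ : ∃ f : (single _ (ComplexShape.up ℤ) i).obj T ⟶ K,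
    (HomotopyCategory.quotient _ _).map f = a := (HomotopyCategory.quotient _ _).map_surjective a
  refine ⟨(singleObjXSelf _ i T).inv ≫ f.f i, ?_, ?_⟩
  · rw [Category.assoc, f.comm, single_obj_d, zero_comp, comp_zero]
  · refine congrArg (HomotopyCategory.quotient _ _).map ?_
    ext1
    simp

lemma rightOrthogonal_finProjStalks_iff (n : ℕ∞) (X : CochainComplex (ModuleCat.{v} R) ℤ) :
    (finProjStalks R n).rightOrthogonal ((HomotopyCategory.quotient _ _).obj X) ↔
      ∀ T, FinProjLT (n + 1) T → HomAcyclic T X := by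
  constructor
  · rintro h T hT i j k hij rfl φ hφ
    exact (homOfCocycle_eq_zero_iff hij φ hφ).1 (h _ ⟨j, T, hT, ⟨Iso.refl _⟩⟩)
  · rintro h Y f ⟨i, T, hT, ⟨e⟩⟩
    obtain ⟨φ, hφ, hf⟩ := exists_homOfCocycle (e.inv ≫ f)
    rw [← cancel_epi e.inv, comp_zero, hf,
      homOfCocycle_eq_zero_iff (sub_add_cancel i 1)]
    exact h T hT _ _ _ (by lia) rfl φ hφ

/-- The `n`-exact complexes are the right orthogonal of the stalks of modules in `𝒫^{<n+1}`. -/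
lemma nExactKb_eq_inverseImage [Small.{v} R] (n : ℕ∞) :
    nExactKb.{u, v} R n =
      (finProjStalks.{u, v} R n).rightOrthogonal.inverseImage (bounded R).ι := by
  ext X
  exact isNExactComplex_iff.trans (rightOrthogonal_finProjStalks_iff n X.obj.as).symm

instance [Small.{v} R] (n : ℕ∞) : (nExactKb.{u, v} R n).IsTriangulated := by
  rw [nExactKb_eq_inverseImage]
  infer_instance

lemma trW_nExactKb_iff [Small.{v} R] (n : ℕ∞) {X Y : Kb.{u, v} R} (f : X ⟶ Y) :
    (nExactKb R n).trW f ↔ (finProjStalks R n).isColocal f.hom := by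
  rw [nExactKb_eq_inverseImage, ObjectProperty.inverseImage_trW_iff,
    ObjectProperty.trW_rightOrthogonal_eq_isColocal]
  rfl

/-! ### Canonical truncation in degrees `≤ 0`. -/

/-- The submodules of the components of a complex which define its canonical truncation
in degrees `≤ 0`. -/
def truncSubmodule (K : CochainComplex (ModuleCat.{v} R) ℤ) (i : ℤ) : Submodule R (K.X i) where
  -- Everything for `i < 0`, the cocycles for `i = 0`, zero for `i > 0`.
  carrier := { x | (0 ≤ i → K.d i (i + 1) x = 0) ∧ (0 < i → x = 0) }
  zero_mem' := by simp
  add_mem' := by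
    rintro x y ⟨h₁, h₂⟩ ⟨h₃, h₄⟩
    exact ⟨fun h ↦ by rw [map_add, h₁ h, h₃ h, add_zero],
      fun h ↦ by rw [h₂ h, h₄ h, add_zero]⟩
  smul_mem' := by
    rintro r x ⟨h₁, h₂⟩
    exact ⟨fun h ↦ by rw [map_smul, h₁ h, smul_zero], fun h ↦ by rw [h₂ h, smul_zero]⟩

lemma d_mem_truncSubmodule {K : CochainComplex (ModuleCat.{v} R) ℤ} {i : ℤ} (j : ℤ) {x : K.X i}
    (hx : x ∈ truncSubmodule K i) : K.d i j x ∈ truncSubmodule K j := by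
  by_cases hij : i + 1 = j
  · subst hij
    exact ⟨fun _ ↦ congr($(K.d_comp_d i (i + 1) (i + 1 + 1)) x), fun h ↦ hx.1 (by lia)⟩
  · rw [K.shape i j hij]
    exact zero_mem _

/-- The canonical truncation of a complex of modules in degrees `≤ 0`. -/
@[simps]
def trunc (K : CochainComplex (ModuleCat.{v} R) ℤ) : CochainComplex (ModuleCat.{v} R) ℤ where
  X i := ModuleCat.of R (truncSubmodule K i)
  d i j := ModuleCat.ofHom ((K.d i j).hom.restrict fun _ ↦ d_mem_truncSubmodule j)
  shape i j hij := 
    ModuleCat.hom_ext (LinearMap.ext fun x ↦ Subtype.ext congr($(K.shape i j hij) x.1))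
  d_comp_d' i j k _ _ := 
    ModuleCat.hom_ext (LinearMap.ext fun x ↦ Subtype.ext congr($(K.d_comp_d i j k) x.1))

/-- The inclusion of the canonical truncation. -/
@[simps]
def truncι (K : CochainComplex (ModuleCat.{v} R) ℤ) : trunc K ⟶ K where
  f i := ModuleCat.ofHom (truncSubmodule K i).subtype
  comm' _ _ _ := rfl

instance (K : CochainComplex (ModuleCat.{v} R) ℤ) (i : ℤ) : Mono ((truncι K).f i) := by
  rw [ModuleCat.mono_iff_injective]
  exact Subtype.val_injective

lemma exists_comp_truncι_f {K : CochainComplex (ModuleCat.{v} R) ℤ} {T : ModuleCat.{v} R} {i : ℤ}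
    (hi : i ≤ 0) (φ : T ⟶ K.X i) (hφ : 0 ≤ i → φ ≫ K.d i (i + 1) = 0) :
    ∃ ψ : T ⟶ (trunc K).X i, ψ ≫ (truncι K).f i = φ :=
  ⟨ModuleCat.ofHom (φ.hom.codRestrict _ fun x ↦
    ⟨fun h ↦ congr($(hφ h) x), fun h ↦ absurd h (by lia)⟩), rfl⟩

lemma isZero_trunc_X (K : CochainComplex (ModuleCat.{v} R) ℤ) {i : ℤ} (hi : 0 < i) :
    IsZero ((trunc K).X i) := by
  have : Subsingleton (truncSubmodule K i) :=
    ⟨fun x y ↦ Subtype.ext ((x.2.2 hi).trans (y.2.2 hi).symm)⟩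
  exact ModuleCat.isZero_of_subsingleton (ModuleCat.of R (truncSubmodule K i))

lemma isZero_trunc_X_of_isZero {K : CochainComplex (ModuleCat.{v} R) ℤ} {i : ℤ}
    (hi : IsZero (K.X i)) : IsZero ((trunc K).X i) := by
  rw [IsZero.iff_id_eq_zero, ← cancel_mono ((truncι K).f i)]
  exact hi.eq_of_tgt _ _

lemma isBounded_trunc {K : CochainComplex (ModuleCat.{v} R) ℤ}
    (hK : ∃ a b : ℤ, K.IsStrictlyGE a ∧ K.IsStrictlyLE b) :
    ∃ a b : ℤ, (trunc K).IsStrictlyGE a ∧ (trunc K).IsStrictlyLE b := by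
  obtain ⟨a, b, _, _⟩ := hK
  refine ⟨a, b, ?_, ?_⟩
  · rw [CochainComplex.isStrictlyGE_iff]
    exact fun i hi ↦ isZero_trunc_X_of_isZero (K.isZero_of_isStrictlyGE a i hi)
  · rw [CochainComplex.isStrictlyLE_iff]
    exact fun i hi ↦ isZero_trunc_X_of_isZero (K.isZero_of_isStrictlyLE b i hi)

/-- A complex whose `Hom(T, -)`-cohomology vanishes in positive degrees has the same
`Hom(T, -)`-cohomology as its truncation. -/
lemma bijective_comp_quotient_map_truncι {K : CochainComplex (ModuleCat.{v} R) ℤ}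
    {T : ModuleCat.{v} R} (i : ℤ)
    (hK : 0 < i → ∀ a : (HomotopyCategory.singleFunctor (ModuleCat.{v} R) i).obj T ⟶
      (HomotopyCategory.quotient _ _).obj K, a = 0) :
    Function.Bijective
      (fun a : (HomotopyCategory.singleFunctor (ModuleCat.{v} R) i).obj T ⟶ _ ↦
        a ≫ (HomotopyCategory.quotient _ _).map (truncι K)) := by
  constructor
  · suffices ∀ a : (HomotopyCategory.singleFunctor (ModuleCat.{v} R) i).obj T ⟶
        (HomotopyCategory.quotient _ _).obj (trunc K),
        a ≫ (HomotopyCategory.quotient _ _).map (truncι K) = 0 → a = 0 from fun a b hab ↦ by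
      simpa [sub_eq_zero] using this (a - b) (by simpa [sub_eq_zero] using hab)
    intro a ha
    obtain ⟨φ, hφ, rfl⟩ := exists_homOfCocycle a
    rw [homOfCocycle_eq_zero_iff (sub_add_cancel i 1)]
    rw [homOfCocycle_comp_eq_zero_iff (sub_add_cancel i 1)] at ha
    obtain hi | hi := lt_or_ge 0 i
    · exact ⟨0, (isZero_trunc_X K hi).eq_of_tgt _ _⟩
    · obtain ⟨ψ, hψ⟩ := ha
      -- The bounding cochain sits in degree `i - 1 < 0`, where truncating changes nothing.
      obtain ⟨ψ, rfl⟩ := exists_comp_truncι_f (by lia) ψ (fun h ↦ absurd h (by lia))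
      refine ⟨ψ, ?_⟩
      rw [← cancel_mono ((truncι K).f i), ← hψ, Category.assoc, Category.assoc, (truncι K).comm]
  · intro a
    obtain hi | hi := lt_or_ge 0 i
    · exact ⟨0, by rw [hK hi a]; exact zero_comp⟩
    · obtain ⟨φ, hφ, rfl⟩ := exists_homOfCocycle a
      obtain ⟨ψ, rfl⟩ := exists_comp_truncι_f hi φ (fun _ ↦ hφ)
      refine ⟨homOfCocycle ψ ?_, homOfCocycle_comp _ _ _⟩
      rw [← cancel_mono ((truncι K).f (i + 1)), Category.assoc, ← (truncι K).comm, zero_comp,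
        ← Category.assoc, hφ]

/-! ### Maps between stalks, and maps from truncated complexes to stalks. -/

lemma homOfCocycle_sub {K : CochainComplex (ModuleCat.{v} R) ℤ} {T : ModuleCat.{v} R}
    {i : ℤ} (φ φ' : T ⟶ K.X i) (hφ : φ ≫ K.d i (i + 1) = 0) (hφ' : φ' ≫ K.d i (i + 1) = 0) :
    homOfCocycle (φ - φ') (by rw [Preadditive.sub_comp, hφ, hφ', sub_zero]) =
      homOfCocycle φ hφ - homOfCocycle φ' hφ' := by
  refine (congrArg (HomotopyCategory.quotient _ _).map (from_single_hom_ext ?_)).trans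
    (Functor.map_sub (HomotopyCategory.quotient _ _))
  rw [sub_f_apply, mkHomFromSingle_f, mkHomFromSingle_f, mkHomFromSingle_f,
    Preadditive.comp_sub]

instance (i : ℤ) : (HomotopyCategory.singleFunctor (ModuleCat.{v} R) i).Faithful := by
  refine ⟨fun {M N f g} h ↦ ?_⟩
  have key (f : M ⟶ N) : (HomotopyCategory.singleFunctor (ModuleCat.{v} R) i).map f =
      homOfCocycle (f ≫ (singleObjXSelf _ i N).inv) (by simp) :=
    congrArg (HomotopyCategory.quotient _ _).map (from_single_hom_ext (by
      rw [mkHomFromSingle_f]; exact single_map_f_self (ComplexShape.up ℤ) i f))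
  rw [key, key] at h
  obtain ⟨ψ, hψ⟩ := (homOfCocycle_eq_zero_iff (sub_add_cancel i 1) _ _).1
    ((homOfCocycle_sub _ _ _ _).trans (sub_eq_zero.2 h))
  -- Stalk complexes have zero differential, so homotopic maps between them are equal.
  rw [single_obj_d, comp_zero, eq_comm, sub_eq_zero] at hψ
  exact (cancel_mono _).1 hψ

lemma isColocal_finProjStalks {n : ℕ∞}
    {X Y : HomotopyCategory (ModuleCat.{v} R) (ComplexShape.up ℤ)} (f : X ⟶ Y)
    (hf : ∀ (i : ℤ) (T : ModuleCat.{v} R), FinProjLT (n + 1) T → Function.Bijective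
      (fun a : (HomotopyCategory.singleFunctor (ModuleCat.{v} R) i).obj T ⟶ X ↦ a ≫ f)) :
    (finProjStalks R n).isColocal f := by
  rintro Z ⟨i, T, hT, ⟨e⟩⟩
  have h := (e.homFromEquiv (Z := Y)).symm.bijective.comp
    ((hf i T hT).comp (e.homFromEquiv (Z := X)).bijective)
  convert h using 2 with a
  simp

/-- For `i > 0` a map from a stalk in degree `i` to `K` becomes zero after composing with `s`, as
`M` sits in degree `0`; injectivity of that composition makes it zero already in `K`. -/
lemma isColocal_quotient_map_truncι {n : ℕ∞} {K : CochainComplex (ModuleCat.{v} R) ℤ}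
    {M : ModuleCat.{v} R} (s : K ⟶ (single _ (ComplexShape.up ℤ) 0).obj M)
    (hs : (finProjStalks R n).isColocal ((HomotopyCategory.quotient _ _).map s)) :
    (finProjStalks R n).isColocal ((HomotopyCategory.quotient _ _).map (truncι K)) := by
  refine isColocal_finProjStalks _ fun i T hT ↦ bijective_comp_quotient_map_truncι i
    fun hi a ↦ (hs _ ⟨i, T, hT, ⟨Iso.refl _⟩⟩).1 ?_
  obtain ⟨φ, hφ, rfl⟩ := exists_homOfCocycle a
  refine ((homOfCocycle_comp_eq_zero_iff (sub_add_cancel i 1) _ _ _).2 ?_).trans zero_comp.symm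
  exact ⟨0, (isZero_single_obj_X _ _ _ _ hi.ne').eq_of_tgt _ _⟩

section

variable [Small.{v} R] {L : CochainComplex (ModuleCat.{v} R) ℤ} {M : ModuleCat.{v} R}
  (t : L ⟶ (single _ (ComplexShape.up ℤ) 0).obj M)

lemma surjective_f_of_bijective
    (ht : Function.Bijective (fun a :
      (HomotopyCategory.singleFunctor (ModuleCat.{v} R) 0).obj (ringSelf R) ⟶ _ ↦
        a ≫ (HomotopyCategory.quotient _ _).map t)) :
    Function.Surjective (t.f 0) := by
  intro x
  obtain ⟨a, ha⟩ := ht.2 (homOfCocycle (ofElement x) (by simp))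
  obtain ⟨φ, hφ, rfl⟩ := exists_homOfCocycle a
  dsimp only at ha
  rw [homOfCocycle_comp, ← sub_eq_zero, ← homOfCocycle_sub,
    homOfCocycle_eq_zero_iff (sub_add_cancel 0 1)] at ha
  obtain ⟨ψ, hψ⟩ := ha
  rw [single_obj_d, comp_zero, eq_comm, sub_eq_zero] at hψ
  refine ⟨φ ((Shrink.linearEquiv R R).symm 1), ?_⟩
  rw [← ModuleCat.comp_apply, hψ, ofElement_apply_one]

lemma exists_d_apply_eq_of_bijective
    (ht : Function.Bijective (fun a :
      (HomotopyCategory.singleFunctor (ModuleCat.{v} R) 0).obj (ringSelf R) ⟶ _ ↦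
        a ≫ (HomotopyCategory.quotient _ _).map t))
    (x : L.X 0) (hx : L.d 0 1 x = 0) (hx' : t.f 0 x = 0) :
    ∃ y, L.d (-1) 0 y = x := by
  have h : homOfCocycle (ofElement x)
      (by rw [ofElement_comp]; erw [hx]; rw [ofElement_zero]) = 0 := by
    apply ht.1
    refine ((homOfCocycle_comp_eq_zero_iff (sub_add_cancel 0 1) _ _ _).2 ?_).trans
      zero_comp.symm
    exact ⟨0, by rw [zero_comp, ofElement_comp, hx', ofElement_zero]⟩
  rw [homOfCocycle_eq_zero_iff (show (-1 : ℤ) + 1 = 0 by simp)] at h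
  obtain ⟨ψ, hψ⟩ := h
  refine ⟨ψ ((Shrink.linearEquiv R R).symm 1), ?_⟩
  rw [← ModuleCat.comp_apply, hψ, ofElement_apply_one]

/-- If `t : L ⟶ M` induces a bijection on `H⁰` and `L¹ = 0`, morphisms from `L` to stalk
complexes factor through `t`. -/
lemma exists_eq_comp_single_map
    (ht : Function.Bijective (fun a :
      (HomotopyCategory.singleFunctor (ModuleCat.{v} R) 0).obj (ringSelf R) ⟶ _ ↦
        a ≫ (HomotopyCategory.quotient _ _).map t))
    (hL : IsZero (L.X 1)) {N : ModuleCat.{v} R}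
    (f : L ⟶ (single _ (ComplexShape.up ℤ) 0).obj N) :
    ∃ g : M ⟶ N, f = t ≫ (single _ _ 0).map g := by
  have hsurj := surjective_f_of_bijective t ht
  -- As `L¹ = 0`, every element of `L⁰` is a cocycle; those killed by `t` are boundaries, which `f`
  -- kills too.
  have hker : LinearMap.ker (t.f 0).hom ≤ LinearMap.ker (f.f 0).hom := by
    intro x hx
    obtain ⟨y, rfl⟩ := exists_d_apply_eq_of_bijective t ht x
      (congr($(hL.eq_of_tgt (L.d 0 1) 0) x)) hx
    have h : L.d (-1) 0 ≫ f.f 0 = 0 := by rw [← f.comm, single_obj_d, comp_zero]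
    exact (congr($h y) :)
  let e := (t.f 0).hom.quotKerEquivOfSurjective hsurj
  let g₀ : ((single _ (ComplexShape.up ℤ) 0).obj M).X 0 ⟶
      ((single _ (ComplexShape.up ℤ) 0).obj N).X 0 :=
    ModuleCat.ofHom (Submodule.liftQ _ _ hker ∘ₗ e.symm.toLinearMap)
  have hg₀ : t.f 0 ≫ g₀ = f.f 0 := by
    ext x
    have : e.symm ((t.f 0).hom x) = Submodule.Quotient.mk x := by
      rw [LinearEquiv.symm_apply_eq]
      rfl
    exact (congrArg (Submodule.liftQ _ _ hker) this).trans (Submodule.liftQ_apply _ _ _)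
  refine ⟨(singleObjXSelf _ 0 M).inv ≫ g₀ ≫ (singleObjXSelf _ 0 N).hom,
    to_single_hom_ext ?_⟩
  simp [single_map_f_self, hg₀]

end

/-! ### Faithfulness and fullness by calculus of right fractions. -/

variable [Small.{v} R]

lemma stalk_comp_quotientFunctor_faithful (n : ℕ∞) :
    (stalk.{u, v} R ⋙ quotientFunctor.{u, v} R n).Faithful where
  map_injective {M N g g'} h := by
    obtain ⟨X, s, hs, eq⟩ := (MorphismProperty.map_eq_iff_precomp
      (quotientFunctor.{u, v} R n) (nExactKb.{u, v} R n).trW _ _).1 h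
    rw [trW_nExactKb_iff] at hs
    have eq' : s.hom ≫ (HomotopyCategory.singleFunctor _ 0).map g =
        s.hom ≫ (HomotopyCategory.singleFunctor _ 0).map g' := congrArg (·.hom) eq
    ext x
    -- The element `x`, as a map from the stalk of `R`, lifts through `s`.
    obtain ⟨a, ha⟩ := (hs _ ⟨0, _, .ringSelf n, ⟨Iso.refl _⟩⟩).2
      ((HomotopyCategory.singleFunctor _ 0).map (ofElement x))
    have : (HomotopyCategory.singleFunctor _ 0).map (ofElement x ≫ g - ofElement x ≫ g') = 0 := by
      rw [Functor.map_sub, Functor.map_comp, Functor.map_comp, ← ha, sub_eq_zero]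
      exact (Category.assoc _ _ _).trans
        ((congrArg (a ≫ ·) eq').trans (Category.assoc _ _ _).symm)
    have := (HomotopyCategory.singleFunctor _ 0).map_injective
      (this.trans (Functor.map_zero _ _ _).symm)
    rw [ofElement_comp, ofElement_comp, sub_eq_zero] at this
    have := congr($this ((Shrink.linearEquiv R R).symm 1))
    rwa [ofElement_apply_one, ofElement_apply_one] at this

lemma stalk_comp_quotientFunctor_full (n : ℕ∞) :
    (stalk.{u, v} R ⋙ quotientFunctor.{u, v} R n).Full where
  map_surjective {M N} α := by
    obtain ⟨φ, rfl⟩ := Localization.exists_rightFraction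
      (quotientFunctor.{u, v} R n) (nExactKb.{u, v} R n).trW α
    obtain @⟨X, s, hs, f⟩ := φ
    obtain ⟨s₀, hs₀⟩ : ∃ s₀ : X.obj.as ⟶ (single _ (ComplexShape.up ℤ) 0).obj M,
        (HomotopyCategory.quotient _ _).map s₀ = s.hom :=
      (HomotopyCategory.quotient _ _).map_surjective s.hom
    obtain ⟨f₀, hf₀⟩ : ∃ f₀ : X.obj.as ⟶ (single _ (ComplexShape.up ℤ) 0).obj N,
        (HomotopyCategory.quotient _ _).map f₀ = f.hom :=
      (HomotopyCategory.quotient _ _).map_surjective f.hom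
    have hs' : (finProjStalks R n).isColocal ((HomotopyCategory.quotient _ _).map s₀) := by
      rw [hs₀]
      exact (trW_nExactKb_iff n s).1 hs
    have hι := isColocal_quotient_map_truncι s₀ hs'
    obtain ⟨g, hg⟩ := exists_eq_comp_single_map (truncι X.obj.as ≫ s₀) (by
      rw [Functor.map_comp]
      exact MorphismProperty.comp_mem _ _ _ hι hs' _ ⟨0, _, .ringSelf n, ⟨Iso.refl _⟩⟩)
      (isZero_trunc_X _ one_pos) (truncι X.obj.as ≫ f₀)
    let X' : Kb.{u, v} R := ⟨(HomotopyCategory.quotient _ _).obj (trunc X.obj.as),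
      isBounded_trunc X.property⟩
    let ι : X' ⟶ X := ObjectProperty.homMk
      ((HomotopyCategory.quotient _ _).map (truncι X.obj.as))
    have hιW : (nExactKb.{u, v} R n).trW ι := (trW_nExactKb_iff n ι).2 hι
    -- After refining the roof by `ι`, its right leg is its left leg followed by `g`; as `ι` and `s`
    -- become invertible, the fraction equals the image of `g`.
    have fac : ι ≫ f = ι ≫ s ≫ (stalk R).map g := by
      apply (bounded R).ι.map_injective
      change (HomotopyCategory.quotient _ _).map (truncι X.obj.as) ≫ f.hom =
        (HomotopyCategory.quotient _ _).map (truncι X.obj.as) ≫ s.hom ≫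
          (HomotopyCategory.singleFunctor _ 0).map g
      rw [← hf₀, ← hs₀]
      refine ((HomotopyCategory.quotient _ _).map_comp _ _).symm.trans
        ((congrArg (HomotopyCategory.quotient _ _).map hg).trans ?_)
      rw [Functor.map_comp, Functor.map_comp, Category.assoc]
      rfl
    refine ⟨g, ?_⟩
    have := Localization.inverts (quotientFunctor.{u, v} R n) _ ι hιW
    have := Localization.inverts (quotientFunctor.{u, v} R n) _ s hs
    rw [← cancel_epi ((quotientFunctor.{u, v} R n).map s)]
    refine Eq.trans ?_ (MorphismProperty.RightFraction.map_s_comp_map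
      (.mk s hs f) (quotientFunctor.{u, v} R n) (Localization.inverts _ _)).symm
    rw [← cancel_epi ((quotientFunctor.{u, v} R n).map ι)]
    dsimp only [Functor.comp_map]
    rw [← Functor.map_comp, ← Functor.map_comp, ← Functor.map_comp, fac]

end NDerived

end

theorem theorem5p8 {R : Type u} [Ring R] [Small.{v} R] (n : ℕ∞) :
    (NDerived.stalk.{u, v} R ⋙ NDerived.quotientFunctor.{u, v} R n).Full ∧
      (NDerived.stalk.{u, v} R ⋙ NDerived.quotientFunctor.{u, v} R n).Faithful :=
  ⟨NDerived.stalk_comp_quotientFunctor_full n, NDerived.stalk_comp_quotientFunctor_faithful n⟩
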